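/- **Setting.** Let $k$ be an infinite field, $R=k[x_1,\dots,x_r]$ with its standard grading, and $S=k[y_1,\dots,y_r]$. Let $R$ act on $S$ in one of the following two ways: - by *differentiation*, $x_i$ acting as $\partial/\partial y_i$; in this case assume $\operatorname{char} k=0$ or $\operatorname{char} k>e$, where $e$ is the socle degree fixed below; - by *contraction*, $x^a\circ y^b=y^{b-a}$ if $a\le b$ componentwise and $x^a\circ y^b=0$ otherwise ($\operatorname{char} k$ arbitrary; here $y^b$ stands for the divided power monomial). For a homogeneous ideal $I\subseteq R$ with $A=R/I$ artinian, the *$h$-vector* of $A$ is $h_i=\dim_k A_i$, the *socle degree* of $A\ne0$ is the largest $e$ with $A_e\neq 0$, and the *socle* of $A$ is $\operatorname{soc}(A)=\{a\in A: a\,\bar x_i=0 \text{ for all } i\}$. The algebra $A$ is *level of type $t$* if $\dim_k\operatorname{soc}(A)_e=t$ and $\operatorname{soc}(A)_i=0$ for $i\ne e$, and *Gorenstein* if it is level of type $1$. Let $I^{-1}=\{G\in S:\varphi\circ G=0\text{ for all }\varphi\in I\}$, and for $G\in S$ let $\operatorname{Ann}(G)=\{\varphi\in R:\varphi\circ G=0\}$.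 **Generic Gorenstein quotients.** Let $A=R/I$ be a level algebra of socle degree $e$ and type $t$ with $h$-vector $h=(1,h_1,\dots,h_e)$, and let $F_1,\dots,F_t$ be a $k$-basis of the degree $e$ component of $I^{-1}$. A sequence $H=(H_u)_{u\ge0}$ is called an *$h$-vector of the generic Gorenstein quotient* of $A$ of socle degree $e$ if there is a nonempty Zariski open subset $U\subseteq\mathbf P^{t-1}(k)$ such that, for every $p=[p_1:\dots:p_t]\in U$, the algebra $R/\operatorname{Ann}(p_1F_1+\dots+p_tF_t)$ is a Gorenstein quotient of $A$ of socle degree $e$ with $h$-vector $H$. **Corollary 2.5.** In this setting there is exactly one such sequence, $H^{1,\mathrm{gen}}$, and for every $u\in\{1,\dots,e\}$ $$H_u^{1,\mathrm{gen}}\;\ge\;\frac{1}{t+1}\left(h_{e-u}+h_u\right).$$ -/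

import Mathlib

open MvPolynomial

noncomputable section

namespace LevelAlgebra

/-- The two standard actions of `R = k[x_1, …, x_r]` on `S = k[y_1, …, y_r]` used for inverse
systems: partial differentiation, and contraction (where `S` is thought of as the divided power
module, the monomials `y^b` standing for the divided powers). -/
inductive ActionKind : Type
  | differentiation
  | contraction

/-- The scalar `c` in `x^a ∘ y^b = c • y^(b - a)`. For differentiation it is
`∏ i, b_i (b_i - 1) ⋯ (b_i - a_i + 1)`, for contraction it is `1`; in both cases it is `0` unless
`a ≤ b`. -/
def ActionKind.weight (k : Type*) [Field k] {r : ℕ} (w : ActionKind) (a b : Fin r →₀ ℕ) : k :=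
  match w with
  | .differentiation => ∏ i, ((b i).descFactorial (a i) : k)
  | .contraction => ∏ i, (if a i ≤ b i then 1 else 0 : k)

/-- The `k`-bilinear action `R × S → S`, determined by `x^a ∘ y^b = weight a b • y^(b - a)`. -/
def act {k : Type*} [Field k] {r : ℕ} (w : ActionKind) :
    MvPolynomial (Fin r) k →ₗ[k] MvPolynomial (Fin r) k →ₗ[k] MvPolynomial (Fin r) k :=
  (basisMonomials (Fin r) k).constr k fun a =>
    (basisMonomials (Fin r) k).constr k fun b => monomial (b - a) (w.weight k a b)

theorem act_monomial {k : Type*} [Field k] {r : ℕ} (w : ActionKind) (a b : Fin r →₀ ℕ) :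
    act w (monomial a (1 : k)) (monomial b (1 : k)) = monomial (b - a) (w.weight k a b) := by
  have h1 := (basisMonomials (Fin r) k).constr_basis k
    (fun a => (basisMonomials (Fin r) k).constr k fun b => monomial (b - a) (w.weight k a b)) a
  have h2 := (basisMonomials (Fin r) k).constr_basis k
    (fun b => monomial (b - a) (w.weight k a b)) b
  simp only [coe_basisMonomials] at h1 h2
  rw [act, h1, h2]

theorem ActionKind.weight_add (k : Type*) [Field k] {r : ℕ} (w : ActionKind)
    (a a' b : Fin r →₀ ℕ) :
    w.weight k (a + a') b = w.weight k a' b * w.weight k a (b - a') := by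
  cases w
  · simp only [ActionKind.weight, ← Finset.prod_mul_distrib]
    refine Finset.prod_congr rfl fun i _ => ?_
    rw [← Nat.cast_mul]
    congr 1
    simp only [Finsupp.coe_add, Pi.add_apply, Finsupp.coe_tsub, Pi.sub_apply]
    induction a i with
    | zero => simp
    | succ n ih =>
      rw [add_right_comm, Nat.descFactorial_succ, Nat.descFactorial_succ, ih,
        show b i - (n + a' i) = b i - a' i - n by omega]
      ring
  · simp only [ActionKind.weight, ← Finset.prod_mul_distrib]
    refine Finset.prod_congr rfl fun i _ => ?_
    simp only [Finsupp.coe_add, Pi.add_apply, Finsupp.coe_tsub, Pi.sub_apply]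
    by_cases h1 : a' i ≤ b i <;> by_cases h2 : a i ≤ b i - a' i
    · simp [h1, h2, show a i + a' i ≤ b i by omega]
    · simp [h2, show ¬ a i + a' i ≤ b i by omega]
    · simp [h1, show ¬ a i + a' i ≤ b i by omega]
    · simp [h1, show ¬ a i + a' i ≤ b i by omega]

/-- The action makes `S` an `R`-module. -/
theorem act_mul {k : Type*} [Field k] {r : ℕ} (w : ActionKind) (φ ψ G : MvPolynomial (Fin r) k) :
    act w (φ * ψ) G = act w φ (act w ψ G) := by
  induction φ using MvPolynomial.induction_on' with
  | add p q hp hq => rw [add_mul, map_add, map_add, LinearMap.add_apply, hp, hq,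
      LinearMap.add_apply]
  | monomial a c =>
  induction ψ using MvPolynomial.induction_on' with
  | add p q hp hq => rw [mul_add, map_add, map_add, LinearMap.add_apply, hp, hq,
      LinearMap.add_apply, map_add]
  | monomial a' c' =>
  induction G using MvPolynomial.induction_on' with
  | add p q hp hq => simp only [map_add, hp, hq]
  | monomial b d =>
  have hm (s : Fin r →₀ ℕ) (x : k) : monomial s x = x • monomial s (1 : k) := by
    rw [smul_monomial, smul_eq_mul, mul_one]
  rw [monomial_mul, hm _ (c * c'), hm a c, hm a' c', hm b d]
  simp only [map_smul, LinearMap.smul_apply, act_monomial]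
  rw [hm (b - a'), map_smul, act_monomial, ActionKind.weight_add, hm (b - a' - a),
    hm (b - (a + a')), tsub_tsub, add_comm a' a]
  simp only [smul_smul]
  congr 1
  ring

/-- For `ActionKind.differentiation`, the variable `x_i` acts as `∂/∂y_i`. -/
theorem act_X_differentiation {k : Type*} [Field k] {r : ℕ} (i : Fin r)
    (G : MvPolynomial (Fin r) k) :
    act .differentiation (X i) G = pderiv i G := by
  induction G using MvPolynomial.induction_on' with
  | add p q hp hq => rw [map_add, map_add, hp, hq]
  | monomial b d =>
  have hm : monomial b d = d • monomial b (1 : k) := by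
    rw [smul_monomial, smul_eq_mul, mul_one]
  rw [hm, map_smul, X, act_monomial, Derivation.map_smul, pderiv_monomial, one_mul, ActionKind.weight,
    Finset.prod_eq_single i (fun j _ hj => by simp [hj.symm]) (by simp)]
  simp

section Algebra

attribute [local instance] MvPolynomial.gradedAlgebra

variable {k : Type*} [Field k] {r : ℕ}

/-- The degree `i` component `A_i` of the algebra `A = R / I`. -/
def gradedPiece (I : Ideal (MvPolynomial (Fin r) k)) (i : ℕ) :
    Submodule k (MvPolynomial (Fin r) k ⧸ I) :=
  (homogeneousSubmodule (Fin r) k i).map (Ideal.Quotient.mkₐ k I).toLinearMap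

/-- The `h`-vector `i ↦ dim_k A_i` of `A = R / I`. -/
def hVector (I : Ideal (MvPolynomial (Fin r) k)) (i : ℕ) : ℕ :=
  Module.finrank k (gradedPiece I i)

/-- The socle of `A = R / I`: the annihilator of the maximal homogeneous ideal
`(x̄_1, …, x̄_r)`. -/
def socle (I : Ideal (MvPolynomial (Fin r) k)) : Submodule k (MvPolynomial (Fin r) k ⧸ I) where
  carrier := {a | ∀ m ∈ Ideal.span (Set.range fun i => Ideal.Quotient.mk I (X i)), a * m = 0}
  add_mem' ha hb m hm := by rw [add_mul, ha m hm, hb m hm, add_zero]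
  zero_mem' m _ := zero_mul m
  smul_mem' c a ha m hm := by rw [smul_mul_assoc, ha m hm, smul_zero]

/-- The socle-vector `i ↦ dim_k soc(A)_i` of `A = R / I`. -/
def socleVector (I : Ideal (MvPolynomial (Fin r) k)) (i : ℕ) : ℕ :=
  Module.finrank k (socle I ⊓ gradedPiece I i : Submodule k (MvPolynomial (Fin r) k ⧸ I))

/-- `R / I` is a standard graded artinian level algebra of socle degree `e` and type `t`. -/
structure IsLevel (I : Ideal (MvPolynomial (Fin r) k)) (e t : ℕ) : Prop where
  homogeneous : I.IsHomogeneous (homogeneousSubmodule (Fin r) k)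
  artinian : IsArtinianRing (MvPolynomial (Fin r) k ⧸ I)
  hVector_pos : 0 < hVector I e
  hVector_eq_zero : ∀ i, e < i → hVector I i = 0
  socleVector_eq : ∀ i, socleVector I i = if i = e then t else 0

/-- Gorenstein means level of type `1`. -/
def IsGorenstein (I : Ideal (MvPolynomial (Fin r) k)) (e : ℕ) : Prop :=
  IsLevel I e 1

/-- The inverse system `I⁻¹`: the elements of `S` annihilated by `I`. -/
def inverseSystem (w : ActionKind) (I : Ideal (MvPolynomial (Fin r) k)) :
    Submodule k (MvPolynomial (Fin r) k) where
  carrier := {G | ∀ φ ∈ I, act w φ G = 0}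
  add_mem' ha hb φ hφ := by rw [map_add, ha φ hφ, hb φ hφ, add_zero]
  zero_mem' φ _ := map_zero _
  smul_mem' c a ha φ hφ := by rw [map_smul, ha φ hφ, smul_zero]

/-- The degree `e` component of the inverse system `I⁻¹`. -/
def inverseSystemPart (w : ActionKind) (I : Ideal (MvPolynomial (Fin r) k)) (e : ℕ) :
    Submodule k (MvPolynomial (Fin r) k) :=
  inverseSystem w I ⊓ homogeneousSubmodule (Fin r) k e

/-- The annihilator `Ann(G) ⊆ R` of `G ∈ S`, that is, of the `R`-submodule generated by `G`. -/
def ann (w : ActionKind) (G : MvPolynomial (Fin r) k) : Ideal (MvPolynomial (Fin r) k) where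
  carrier := {φ | act w φ G = 0}
  add_mem' {a b} ha hb := by
    change act w (a + b) G = 0
    rw [map_add, LinearMap.add_apply, ha, hb, add_zero]
  zero_mem' := by
    change act w 0 G = 0
    rw [map_zero, LinearMap.zero_apply]
  smul_mem' c a ha := by
    change act w (c * a) G = 0
    rw [act_mul, ha, map_zero]

end Algebra

/-- Zariski open subsets of `ℙ^(t-1)(k)`: complements of the common zero loci of sets of
homogeneous polynomials. -/
def IsZariskiOpen {k : Type*} [Field k] {t : ℕ} (U : Set (Projectivization k (Fin t → k))) :
    Prop :=
  ∃ T : Set (MvPolynomial (Fin t) k), (∀ g ∈ T, ∃ d, g.IsHomogeneous d) ∧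
    U = {p | ∃ g ∈ T, eval p.rep g ≠ 0}

/-- The form `p_1 F_1 + ⋯ + p_t F_t` (well defined up to a nonzero scalar) attached to the point
`p` of `ℙ^(t-1)(k)`. -/
def formAt {k : Type*} [Field k] {r t : ℕ} (F : Fin t → MvPolynomial (Fin r) k)
    (p : Projectivization k (Fin t → k)) : MvPolynomial (Fin r) k :=
  ∑ j, p.rep j • F j

/-- `H` is the `h`-vector of the generic Gorenstein quotients of `R / I` of socle degree `e`: there
is a nonempty Zariski open subset `U` of `ℙ^(t-1)(k)` such that, for all points `p` of `U`, the
algebra `R / Ann(p_1 F_1 + ⋯ + p_t F_t)` is a Gorenstein quotient of `R / I` of socle degree `e`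
with `h`-vector `H`. -/
def IsGenericGorensteinHVector {k : Type*} [Field k] {r t : ℕ} (w : ActionKind)
    (I : Ideal (MvPolynomial (Fin r) k)) (e : ℕ) (F : Fin t → MvPolynomial (Fin r) k)
    (H : ℕ → ℕ) : Prop :=
  ∃ U : Set (Projectivization k (Fin t → k)), IsZariskiOpen U ∧ U.Nonempty ∧
    ∀ p ∈ U, I ≤ ann w (formAt F p) ∧ IsGorenstein (ann w (formAt F p)) e ∧
      ∀ u, hVector (ann w (formAt F p)) u = H u

end LevelAlgebra

end

/-! Fix a degree `u ≤ e` and consider the maps `f j : R_u → S`, `φ ↦ φ ∘ F j`. For `G = ∑ p_j F_j`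
the value at `u` of the h-vector of `R / Ann(G)` is the rank of `∑ p_j f j`. Having maximal rank is
an open condition on `p`, and only the degrees up to `e` matter, so one nonzero homogeneous
polynomial cuts out an open set where all these ranks are maximal. Every nonzero form of degree `e`
defines a Gorenstein algebra of socle degree `e`, which gives existence; uniqueness holds because
nonempty open sets meet over an infinite field.

The inequality is linear algebra. Let `g = ∑ p_j f j` have maximal rank `m`. Perturbing `g` by any
`f j` cannot raise the rank, and this forces `dim f_j(ker g) + rank (f_j mod range g) ≤ m`
(`finrank_map_ker_add_finrank_range_mkQ_le`). One of the `f j` is a combination of `g` and the other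
`t - 1`. Summing over those bounds `dim ker g` modulo the common kernel, together with the dimension
of the sum of the ranges modulo `range g`, by `(t - 1) m`; the two further copies of `m` are `dim
range g` and the rank of `g` in rank-nullity (`finrank_add_finrank_iSup_range_le`).

Macaulay duality translates this: levelness makes the common kernel equal to `I_u`, and the sum of
the ranges has dimension at least `h_{e-u}`. -/

namespace LevelAlgebra

/-! ### Maximal rank in linear systems of maps -/

section LinearAlgebra

open Module

variable {k V W : Type*} [Field k] [AddCommGroup V] [Module k V] [AddCommGroup W] [Module k W]

/-- Linear independence is an open condition in a linear system of vectors: if the vectors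
`∑ j, p j • z a j` are independent at `p₀`, then they are so wherever a suitable homogeneous
polynomial does not vanish. -/
theorem exists_isHomogeneous_linearIndependent {ι κ : Type*} [Fintype ι] [Fintype κ]
    (z : κ → ι → W) (p₀ : ι → k) (hv : LinearIndependent k fun a => ∑ j, p₀ j • z a j) :
    ∃ D : MvPolynomial ι k, D.IsHomogeneous (Fintype.card κ) ∧ eval p₀ D ≠ 0 ∧
      ∀ p, eval p D ≠ 0 → LinearIndependent k fun a => ∑ j, p j • z a j := by
  classical
  -- A left inverse at `p₀` reduces independence to a square determinant of linear forms, equal to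
  -- `1` at `p₀`.
  obtain ⟨l, hl⟩ := LinearMap.exists_leftInverse_of_injective
    (Fintype.linearCombination k fun a => ∑ j, p₀ j • z a j)
    (LinearMap.ker_eq_bot.2 (linearIndependent_iff_injective_fintypeLinearCombination.1 hv))
  let M : Matrix κ κ (MvPolynomial ι k) := fun b a => ∑ j, C (l (z a j) b) * X j
  have hM (p : ι → k) : (eval p).mapMatrix M = fun b a => l (∑ j, p j • z a j) b := by
    ext b a
    rw [RingHom.mapMatrix_apply, Matrix.map_apply]
    simp [M, mul_comm]
  refine ⟨M.det, ?_, ?_, fun p hp => ?_⟩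
  · rw [Matrix.det_apply]
    refine IsHomogeneous.sum _ _ _ fun σ _ => ?_
    have h : (∏ b, M (σ b) b).IsHomogeneous (∑ _b : κ, 1) := IsHomogeneous.prod _ _ _ fun b _ =>
      IsHomogeneous.sum _ _ _ fun j _ => isHomogeneous_C_mul_X _ _
    rw [Finset.sum_const, smul_eq_mul, mul_one, Finset.card_univ] at h
    rw [Units.smul_def, ← Int.cast_smul_eq_zsmul k]
    exact (homogeneousSubmodule ι k _).smul_mem _ h
  · rw [RingHom.map_det, hM]
    have : (fun b a => l (∑ j, p₀ j • z a j) b) = (1 : Matrix κ κ k) := by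
      ext b a
      have := LinearMap.congr_fun hl (Pi.single a 1)
      rw [LinearMap.comp_apply, Fintype.linearCombination_apply_single, one_smul] at this
      rw [this, LinearMap.id_apply, Matrix.one_apply, Pi.single_apply]
    rw [this, Matrix.det_one]
    exact one_ne_zero
  · rw [RingHom.map_det, hM] at hp
    have h := Matrix.linearIndependent_cols_iff_isUnit.2
      ((Matrix.isUnit_iff_isUnit_det _).2 (isUnit_iff_ne_zero.2 hp))
    exact LinearIndependent.of_comp l h

theorem exists_linearIndependent_comp (f : V →ₗ[k] W) [FiniteDimensional k V] :
    ∃ v : Fin (finrank k (LinearMap.range f)) → V, LinearIndependent k fun a => f (v a) := by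
  let b := finBasis k (LinearMap.range f)
  choose v hv using fun a => (b a).2
  refine ⟨v, ?_⟩
  have := b.linearIndependent.map' (LinearMap.range f).subtype (Submodule.ker_subtype _)
  simpa only [Function.comp_def, Submodule.subtype_apply, ← hv] using this

/-- Lower semicontinuity of rank: vectors whose images form a basis of the range at `p₀` keep
independent images nearby. -/
theorem exists_isHomogeneous_finrank_range_le {ι : Type*} [Fintype ι] [FiniteDimensional k V]
    (f : ι → V →ₗ[k] W) (p₀ : ι → k) :
    ∃ (D : MvPolynomial ι k) (d : ℕ), D.IsHomogeneous d ∧ eval p₀ D ≠ 0 ∧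
      ∀ p, eval p D ≠ 0 → finrank k (LinearMap.range (∑ j, p₀ j • f j)) ≤
        finrank k (LinearMap.range (∑ j, p j • f j)) := by
  obtain ⟨v, hv⟩ := exists_linearIndependent_comp (∑ j, p₀ j • f j)
  obtain ⟨D, hD, h0, h⟩ := exists_isHomogeneous_linearIndependent (fun a j => f j (v a)) p₀
    (by simpa using hv)
  refine ⟨D, _, hD, h0, fun p hp => ?_⟩
  have h1 : LinearIndependent k fun a =>
      (⟨(∑ j, p j • f j) (v a), v a, rfl⟩ : LinearMap.range (∑ j, p j • f j)) := by
    refine LinearIndependent.of_comp (LinearMap.range (∑ j, p j • f j)).subtype ?_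
    simpa [Function.comp_def] using h p hp
  simpa using h1.fintype_card_le_finrank

theorem exists_eval_ne_zero {ι : Type*} [Infinite k] {D : MvPolynomial ι k} (hD : D ≠ 0) :
    ∃ p, eval p D ≠ 0 := by
  by_contra! h
  exact hD (MvPolynomial.funext fun p => by rw [h p, map_zero])

/-- If `f` has maximal rank in its pencil with `g`, a vector outside the range of `f` is outside
the range of a general member of the pencil. -/
theorem exists_notMem_range_pencil [Infinite k] [FiniteDimensional k V] {f g : V →ₗ[k] W}
    (hmax : ∀ s x : k, finrank k (LinearMap.range (s • f + x • g)) ≤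
      finrank k (LinearMap.range f)) {y : W} (hy : y ∉ LinearMap.range f) :
    ∃ s x : k, s ≠ 0 ∧ x ≠ 0 ∧ y ∉ LinearMap.range (s • f + x • g) := by
  obtain ⟨v, hv⟩ := exists_linearIndependent_comp f
  -- At `(s, x)` this family is `s • y` together with the `s • f (v a) + x • g (v a)`. It is
  -- independent at `(1, 0)`, hence generically; if `y` lay in the range of `s • f + x • g`, that
  -- rank would exceed the rank of `f`.
  let z : Option (Fin (finrank k (LinearMap.range f))) → Fin 2 → W := fun o =>
    o.elim ![y, 0] fun a => ![f (v a), g (v a)]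
  obtain ⟨D, -, h0, h⟩ := exists_isHomogeneous_linearIndependent z (![1, 0] : Fin 2 → k) (by
    rw [linearIndependent_option]
    refine ⟨by simpa [z, Function.comp_def] using hv, fun hmem => hy ?_⟩
    have hle : Submodule.span k (Set.range fun a => f (v a)) ≤ LinearMap.range f :=
      Submodule.span_le.2 (by rintro _ ⟨a, rfl⟩; exact ⟨v a, rfl⟩)
    apply hle
    simpa [z, Function.comp_def] using hmem)
  have hD : D ≠ 0 := by
    rintro rfl
    simp at h0
  -- The two variables are multiplied in so that both coordinates of the point are nonzero.
  obtain ⟨p, hp⟩ := exists_eval_ne_zero (mul_ne_zero hD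
    (mul_ne_zero (X_ne_zero (R := k) (0 : Fin 2)) (X_ne_zero (R := k) (1 : Fin 2))))
  simp only [map_mul, eval_X, mul_ne_zero_iff] at hp
  refine ⟨p 0, p 1, hp.2.1, hp.2.2, fun hmem => ?_⟩
  have hli := h p hp.1
  have hr (o) : ∑ j, p j • z o j ∈ LinearMap.range (p 0 • f + p 1 • g) := by
    cases o with
    | none => simpa [z] using Submodule.smul_mem _ (p 0) hmem
    | some a => exact ⟨v a, by simp [z]⟩
  have h1 : LinearIndependent k fun o =>
      (⟨_, hr o⟩ : LinearMap.range (p 0 • f + p 1 • g)) :=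
    LinearIndependent.of_comp (LinearMap.range (p 0 • f + p 1 • g)).subtype hli
  have := h1.fintype_card_le_finrank
  have := hmax (p 0) (p 1)
  simp at *
  omega

theorem finrank_map_add_finrank_inf_ker (f : V →ₗ[k] W) (P : Submodule k V)
    [FiniteDimensional k P] :
    finrank k (P.map f) + finrank k (P ⊓ LinearMap.ker f : Submodule k V) = finrank k P := by
  rw [← LinearMap.finrank_range_add_finrank_ker (f.domRestrict P), LinearMap.range_domRestrict,
    LinearMap.ker_domRestrict, ← Submodule.finrank_map_subtype_eq P, Submodule.map_comap_subtype]

/-- First and second order conditions for `f` to have maximal rank in the pencil: `g` maps `ker f`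
into `range f`, and maps `P = f⁻¹(g(ker f))` into `range f` as well. Since `dim P = dim g(ker f) +
dim ker f`, the rank of `g` modulo `range f` is at most `dim V - dim P`. -/
theorem finrank_map_ker_add_finrank_range_mkQ_le [Infinite k] [FiniteDimensional k V]
    {f g : V →ₗ[k] W}
    (hmax : ∀ s x : k, finrank k (LinearMap.range (s • f + x • g)) ≤
      finrank k (LinearMap.range f)) :
    finrank k ((LinearMap.ker f).map g) +
      finrank k (LinearMap.range ((LinearMap.range f).mkQ ∘ₗ g)) ≤
        finrank k (LinearMap.range f) := by
  have h1 : (LinearMap.ker f).map g ≤ LinearMap.range f := by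
    rintro _ ⟨v, hv, rfl⟩
    by_contra hy
    obtain ⟨s, x, -, hx, h⟩ := exists_notMem_range_pencil hmax hy
    refine h ⟨x⁻¹ • v, ?_⟩
    have hv' : f v = 0 := hv
    simp [hv', smul_smul, hx]
  set P := ((LinearMap.ker f).map g).comap f with hP
  have h2 : P ≤ LinearMap.ker ((LinearMap.range f).mkQ ∘ₗ g) := by
    rintro u ⟨v, hv, hvu⟩
    rw [LinearMap.mem_ker, LinearMap.comp_apply, Submodule.mkQ_apply,
      Submodule.Quotient.mk_eq_zero]
    by_contra hy
    obtain ⟨s, x, -, hx, h⟩ := exists_notMem_range_pencil hmax hy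
    -- With `f v = 0` and `f u = g v`, the cross terms cancel: `(s f + x g)(s v - x u) = -x² g u`.
    refine h ⟨-(x⁻¹ * x⁻¹) • (s • v - x • u), ?_⟩
    have hv' : f v = 0 := hv
    simp only [map_smul, map_sub, LinearMap.add_apply, LinearMap.smul_apply, hv', hvu, smul_zero,
      zero_add]
    have hx2 : x⁻¹ * x⁻¹ * (x * x) = 1 := by field_simp
    rw [smul_add, smul_smul s x, smul_smul x s, mul_comm x s, smul_smul x x, sub_add_cancel_left,
      neg_smul, smul_neg, neg_neg, smul_smul, hx2, one_smul]
  have h3 := finrank_map_add_finrank_inf_ker f P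
  rw [hP, Submodule.map_comap_eq_of_le h1, inf_eq_right.2 (LinearMap.ker_le_comap f), ← hP] at h3
  have h4 := LinearMap.finrank_range_add_finrank_ker f
  have h5 := LinearMap.finrank_range_add_finrank_ker ((LinearMap.range f).mkQ ∘ₗ g)
  have h6 := Submodule.finrank_mono h2
  omega

/-- Intersecting with one more kernel costs the image of the current, smaller subspace, which is at
most the image of `K`. -/
theorem finrank_le_finrank_inf_ker_add_sum {ι : Type*} [FiniteDimensional k V]
    (f : ι → V →ₗ[k] W) (K : Submodule k V) (s : Finset ι) :
    finrank k K ≤ finrank k (K ⊓ s.inf fun j => LinearMap.ker (f j) : Submodule k V) +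
      ∑ j ∈ s, finrank k (K.map (f j)) := by
  classical
  induction s using Finset.induction_on with
  | empty => rw [Finset.inf_empty, inf_top_eq, Finset.sum_empty, add_zero]
  | insert a s ha ih =>
    rw [Finset.sum_insert ha, Finset.inf_insert, inf_left_comm, inf_comm]
    have h := finrank_map_add_finrank_inf_ker (f a)
      (K ⊓ s.inf fun j => LinearMap.ker (f j) : Submodule k V)
    have := Submodule.finrank_mono (Submodule.map_mono (f := f a)
      (inf_le_left : K ⊓ (s.inf fun j => LinearMap.ker (f j)) ≤ K))
    omega

/-- Each new range adds its dimension modulo the current, larger sum, which is at most its dimension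
modulo `G`. -/
theorem finrank_sup_range_le_add_sum {ι : Type*} [FiniteDimensional k V]
    (f : ι → V →ₗ[k] W) (G : Submodule k W) [FiniteDimensional k G] (s : Finset ι) :
    finrank k (G ⊔ s.sup fun j => LinearMap.range (f j) : Submodule k W) ≤ finrank k G +
      ∑ j ∈ s, finrank k (LinearMap.range (G.mkQ ∘ₗ f j)) := by
  classical
  induction s using Finset.induction_on with
  | empty => rw [Finset.sup_empty, sup_bot_eq, Finset.sum_empty, add_zero]
  | insert a s ha ih =>
    rw [Finset.sum_insert ha, Finset.sup_insert, sup_left_comm, sup_comm]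
    have h1 := Submodule.finrank_sup_add_finrank_inf_eq
      (G ⊔ s.sup fun j => LinearMap.range (f j)) (LinearMap.range (f a))
    have h2 := finrank_map_add_finrank_inf_ker G.mkQ (LinearMap.range (f a))
    rw [← LinearMap.range_comp, Submodule.ker_mkQ] at h2
    have h3 : finrank k (LinearMap.range (f a) ⊓ G : Submodule k W) ≤
        finrank k ((G ⊔ s.sup fun j => LinearMap.range (f j)) ⊓ LinearMap.range (f a) :
          Submodule k W) :=
      Submodule.finrank_mono (le_inf (inf_le_right.trans le_sup_left) inf_le_left)
    omega

/-- A bound for the maximal rank in a linear system of maps, in terms of the common kernel and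
the sum of the ranges. -/
theorem finrank_add_finrank_iSup_range_le [Infinite k] {ι : Type*} [Fintype ι]
    [FiniteDimensional k V] (f : ι → V →ₗ[k] W) {p : ι → k} (hp : p ≠ 0)
    (hmax : ∀ q : ι → k, finrank k (LinearMap.range (∑ j, q j • f j)) ≤
      finrank k (LinearMap.range (∑ j, p j • f j))) :
    finrank k V + finrank k (⨆ j, LinearMap.range (f j) : Submodule k W) ≤
      (Fintype.card ι + 1) * finrank k (LinearMap.range (∑ j, p j • f j)) +
        finrank k (⨅ j, LinearMap.ker (f j) : Submodule k V) := by
  classical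
  obtain ⟨i, hi⟩ := Function.ne_iff.1 hp
  have hi : p i ≠ 0 := hi
  set g := ∑ j, p j • f j with hg
  set s := Finset.univ.erase i with hs
  -- Replacing `f i` by `g` leaves only `card ι - 1` maps to estimate, whence the factor `card ι +
  -- 1` and not `card ι + 2`.
  have hfi : f i = (p i)⁻¹ • (g - ∑ j ∈ s, p j • f j) := by
    rw [hg, ← Finset.add_sum_erase _ _ (Finset.mem_univ i), add_sub_cancel_right, smul_smul,
      inv_mul_cancel₀ hi, one_smul]
  have h1 (j) (_ : j ∈ s) : finrank k ((LinearMap.ker g).map (f j)) +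
      finrank k (LinearMap.range ((LinearMap.range g).mkQ ∘ₗ f j)) ≤
        finrank k (LinearMap.range g) := by
    refine finrank_map_ker_add_finrank_range_mkQ_le fun a x => ?_
    -- The pencil of `g` and `f j` lies in the linear system, so `g` has maximal rank in it.
    have h : a • g + x • f j = ∑ l, (a • p + x • Pi.single j (1 : k) : ι → k) l • f l := by
      simp [add_smul, Finset.sum_add_distrib, hg, Finset.smul_sum, smul_smul, Pi.single_apply,
        ite_smul]
    rw [h]
    exact hmax _
  have h2 := Finset.sum_le_sum h1
  rw [Finset.sum_add_distrib, Finset.sum_const, smul_eq_mul] at h2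
  have h3 := finrank_le_finrank_inf_ker_add_sum f (LinearMap.ker g) s
  have h4 := finrank_sup_range_le_add_sum f (LinearMap.range g) s
  have h5 : LinearMap.ker g ⊓ (s.inf fun j => LinearMap.ker (f j)) ≤
      ⨅ j, LinearMap.ker (f j) := by
    intro v hv
    simp only [Submodule.mem_inf, Submodule.mem_finsetInf, LinearMap.mem_ker] at hv
    refine (Submodule.mem_iInf _).2 fun j => ?_
    by_cases hj : j = i
    · subst hj
      rw [LinearMap.mem_ker, hfi, LinearMap.smul_apply, LinearMap.sub_apply, hv.1,
        LinearMap.sum_apply, Finset.sum_eq_zero fun j hj => by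
          rw [LinearMap.smul_apply, hv.2 j hj, smul_zero], sub_zero, smul_zero]
    · exact hv.2 j (Finset.mem_erase.2 ⟨hj, Finset.mem_univ j⟩)
  have h6 : (⨆ j, LinearMap.range (f j)) ≤
      LinearMap.range g ⊔ s.sup fun j => LinearMap.range (f j) := by
    have hle (j) (hj : j ∈ s) : LinearMap.range (f j) ≤
        LinearMap.range g ⊔ s.sup fun j => LinearMap.range (f j) :=
      (Finset.le_sup (f := fun j => LinearMap.range (f j)) hj).trans le_sup_right
    refine iSup_le fun j => ?_
    by_cases hj : j = i
    · subst hj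
      rintro _ ⟨v, rfl⟩
      rw [hfi, LinearMap.smul_apply, LinearMap.sub_apply, LinearMap.sum_apply s]
      exact Submodule.smul_mem _ _ (Submodule.sub_mem _ (le_sup_left (a := LinearMap.range g)
        (LinearMap.mem_range_self g v)) (Submodule.sum_mem _ fun l hl => Submodule.smul_mem _ _ (hle l hl ⟨v, rfl⟩)))
    · exact hle j (Finset.mem_erase.2 ⟨hj, Finset.mem_univ j⟩)
  have h7 := Submodule.finrank_mono h5
  have h8 := Submodule.finrank_mono h6
  have h9 := LinearMap.finrank_range_add_finrank_ker g
  have h10 : s.card + 1 = Fintype.card ι := by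
    rw [hs, Finset.card_erase_add_one (Finset.mem_univ i), Finset.card_univ]
  rw [← h10]
  have h11 : (s.card + 1 + 1) * finrank k (LinearMap.range g) =
    s.card * finrank k (LinearMap.range g) + 2 * finrank k (LinearMap.range g) := by ring
  omega

end LinearAlgebra
end LevelAlgebra

namespace LevelAlgebra

/-! ### Degrees and nondegeneracy of the action -/

section Action

variable {k : Type*} [Field k] {r : ℕ}

theorem ActionKind.weight_eq_zero {w : ActionKind} {a b : Fin r →₀ ℕ} (h : ¬ a ≤ b) :
    w.weight k a b = 0 := by
  obtain ⟨i, hi⟩ : ∃ i, ¬ a i ≤ b i := by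
    by_contra! h'
    exact h h'
  cases w
  · exact Finset.prod_eq_zero (Finset.mem_univ i)
      (by rw [Nat.descFactorial_eq_zero_iff_lt.2 (not_le.1 hi), Nat.cast_zero])
  · exact Finset.prod_eq_zero (Finset.mem_univ i) (if_neg hi)

/-- The action is nondegenerate in degrees at most `e`: the characteristic is `0` or exceeds `e`
in the case of differentiation. -/
def ActionKind.Admissible (k : Type*) [Field k] (w : ActionKind) (e : ℕ) : Prop :=
  w = ActionKind.differentiation → ringChar k = 0 ∨ e < ringChar k

theorem ActionKind.Admissible.weight_ne_zero {w : ActionKind} {e : ℕ} (hw : w.Admissible k e)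
    {a b : Fin r →₀ ℕ} (h : a ≤ b) (hb : b.degree ≤ e) : w.weight k a b ≠ 0 := by
  cases w
  · refine Finset.prod_ne_zero_iff.2 fun i _ h0 => ?_
    have hbi : b i ≤ e := (Finsupp.le_degree i b).trans hb
    rcases hw rfl with hc | hc
    · have := (CharP.ringChar_zero_iff_CharZero k).1 hc
      rw [Nat.cast_eq_zero, Nat.descFactorial_eq_zero_iff_lt] at h0
      exact absurd (h i) (not_le.2 h0)
    · have hp : (ringChar k).Prime :=
        (CharP.char_is_prime_or_zero k (ringChar k)).resolve_right (by omega)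
      rw [ringChar.spec] at h0
      have h1 := Nat.factorial_mul_descFactorial (h i)
      have h2 : ringChar k ∣ (b i).factorial := h1 ▸ h0.mul_left _
      have := (hp.dvd_factorial).1 h2
      omega
  · refine Finset.prod_ne_zero_iff.2 fun i _ => ?_
    rw [if_pos (h i)]
    exact one_ne_zero

theorem coeff_act_monomial (w : ActionKind) (a c : Fin r →₀ ℕ) (G : MvPolynomial (Fin r) k) :
    coeff c (act w (monomial a 1) G) = w.weight k a (c + a) * coeff (c + a) G := by
  classical
  induction G using MvPolynomial.induction_on' with
  | add p q hp hq => rw [map_add, coeff_add, hp, hq, coeff_add, mul_add]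
  | monomial b d =>
  have hm : monomial b d = d • monomial b (1 : k) := by rw [smul_monomial, smul_eq_mul, mul_one]
  rw [hm, map_smul, act_monomial, coeff_smul, coeff_smul, coeff_monomial, coeff_monomial]
  by_cases hab : a ≤ b
  · have : b - a = c ↔ b = c + a := tsub_eq_iff_eq_add_of_le hab
    by_cases h : b = c + a
    · rw [if_pos (this.2 h), if_pos h, h, smul_eq_mul, smul_eq_mul]
      ring
    · rw [if_neg fun h' => h (this.1 h'), if_neg h, smul_zero, mul_zero]
  · have h : b ≠ c + a := by
      rintro rfl
      exact hab le_add_self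
    rw [if_neg h, ActionKind.weight_eq_zero hab, ite_self, smul_zero, mul_zero]

theorem coeff_act (w : ActionKind) (φ G : MvPolynomial (Fin r) k) (c : Fin r →₀ ℕ) :
    coeff c (act w φ G) =
      ∑ a ∈ φ.support, coeff a φ * (w.weight k a (c + a) * coeff (c + a) G) := by
  conv_lhs => rw [φ.as_sum]
  rw [map_sum, LinearMap.sum_apply, coeff_sum]
  refine Finset.sum_congr rfl fun a _ => ?_
  have hm : monomial a (coeff a φ) = coeff a φ • monomial a (1 : k) := by
    rw [smul_monomial, smul_eq_mul, mul_one]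
  rw [hm, map_smul, LinearMap.smul_apply, coeff_smul, coeff_act_monomial, smul_eq_mul]

theorem act_comm (w : ActionKind) (φ ψ G : MvPolynomial (Fin r) k) :
    act w φ (act w ψ G) = act w ψ (act w φ G) := by
  rw [← act_mul, mul_comm, act_mul]

/-- An equation without truncated subtraction, so that it gives both the degree of `φ ∘ G` and its
vanishing when `d < i`. -/
theorem exists_degree_of_coeff_act_ne_zero {w : ActionKind} {φ G : MvPolynomial (Fin r) k}
    {i d : ℕ} (hφ : φ.IsHomogeneous i) (hG : G.IsHomogeneous d) {c : Fin r →₀ ℕ}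
    (hc : coeff c (act w φ G) ≠ 0) : c.degree + i = d := by
  rw [coeff_act] at hc
  obtain ⟨a, ha, h⟩ := Finset.exists_ne_zero_of_sum_ne_zero hc
  have h1 : a.degree = i := by
    by_contra h1
    exact mem_support_iff.1 ha (hφ.coeff_eq_zero h1)
  have h2 : (c + a).degree = d := by
    by_contra h2
    rw [hG.coeff_eq_zero h2, mul_zero, mul_zero] at h
    exact h rfl
  rw [← h2, ← h1, map_add]

theorem isHomogeneous_of_coeff {G : MvPolynomial (Fin r) k} {d : ℕ}
    (h : ∀ c, coeff c G ≠ 0 → c.degree = d) : G.IsHomogeneous d := by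
  intro c hc
  rw [← h c hc, Finsupp.degree_eq_weight_one]
  rfl

theorem isHomogeneous_act (w : ActionKind) {φ G : MvPolynomial (Fin r) k} {i d : ℕ}
    (hφ : φ.IsHomogeneous i) (hG : G.IsHomogeneous d) : (act w φ G).IsHomogeneous (d - i) :=
  isHomogeneous_of_coeff fun c hc => by
    have := exists_degree_of_coeff_act_ne_zero hφ hG hc
    omega

theorem act_eq_zero_of_lt (w : ActionKind) {φ G : MvPolynomial (Fin r) k} {i d : ℕ}
    (hφ : φ.IsHomogeneous i) (hG : G.IsHomogeneous d) (h : d < i) : act w φ G = 0 := by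
  ext c
  by_contra hc
  have := exists_degree_of_coeff_act_ne_zero hφ hG hc
  omega

theorem homogeneousComponent_act (w : ActionKind) (φ : MvPolynomial (Fin r) k)
    {G : MvPolynomial (Fin r) k} {i e : ℕ} (hG : G.IsHomogeneous e) (hi : i ≤ e) :
    homogeneousComponent (e - i) (act w φ G) = act w (homogeneousComponent i φ) G := by
  induction φ using MvPolynomial.induction_on' with
  | add p q hp hq => simp only [map_add, LinearMap.add_apply, hp, hq]
  | monomial a c =>
  have ha := isHomogeneous_monomial (R := k) c (rfl : a.degree = a.degree)
  rw [homogeneousComponent_of_mem ((mem_homogeneousSubmodule _ _).2 ha)]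
  split_ifs with h
  · rw [homogeneousComponent_of_mem ((mem_homogeneousSubmodule _ _).2 (isHomogeneous_act w ha hG)),
      if_pos (by omega)]
  · rcases lt_or_ge e a.degree with h' | h'
    · rw [act_eq_zero_of_lt w ha hG h', map_zero, map_zero, LinearMap.zero_apply]
    · rw [homogeneousComponent_of_mem
        ((mem_homogeneousSubmodule _ _).2 (isHomogeneous_act w ha hG)), if_neg (by omega), map_zero,
        LinearMap.zero_apply]

variable {w : ActionKind} {e : ℕ}

/-- Nondegeneracy of the pairing `R_d × S_d → k`: monomials are dual to each other up to weights,
which are nonzero for `d ≤ e`. -/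
theorem eq_zero_of_coeff_zero_act (hw : w.Admissible k e) {G : MvPolynomial (Fin r) k} {d : ℕ}
    (hG : G.IsHomogeneous d) (hd : d ≤ e)
    (h : ∀ φ : MvPolynomial (Fin r) k, φ.IsHomogeneous d → coeff 0 (act w φ G) = 0) : G = 0 := by
  ext b
  rw [coeff_zero]
  by_cases hb : b.degree = d
  · have := h _ (isHomogeneous_monomial 1 hb)
    rw [coeff_act_monomial, zero_add] at this
    exact (mul_eq_zero.1 this).resolve_left (hw.weight_ne_zero le_rfl (hb.trans_le hd))
  · exact hG.coeff_eq_zero hb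

theorem eq_zero_of_act_X (hw : w.Admissible k e) {G : MvPolynomial (Fin r) k} {d : ℕ}
    (hG : G.IsHomogeneous d) (hd : d ≤ e) (hd0 : d ≠ 0) (h : ∀ j, act w (X j) G = 0) : G = 0 := by
  ext b
  rw [coeff_zero]
  by_cases hb : b.degree = d
  · obtain ⟨j, hj⟩ : ∃ j, b j ≠ 0 := by
      by_contra! hb0
      apply hd0
      rw [← hb, Finsupp.degree_eq_zero_iff]
      exact Finsupp.ext hb0
    have hle : Finsupp.single j 1 ≤ b := by
      rw [Finsupp.single_le_iff]
      omega
    have := congrArg (coeff (b - Finsupp.single j 1)) (h j)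
    rw [X, coeff_act_monomial, tsub_add_cancel_of_le hle, coeff_zero] at this
    exact (mul_eq_zero.1 this).resolve_left (hw.weight_ne_zero hle (hb.trans_le hd))
  · exact hG.coeff_eq_zero hb

/-- Every functional on the forms of degree `e` is represented by a form of degree `e`. -/
theorem exists_coeff_zero_act_eq (hw : w.Admissible k e) (l : MvPolynomial (Fin r) k →ₗ[k] k) :
    ∃ G : MvPolynomial (Fin r) k, G.IsHomogeneous e ∧
      ∀ φ : MvPolynomial (Fin r) k, φ.IsHomogeneous e → coeff 0 (act w φ G) = l φ := by
  classical
  let S : Finset (Fin r →₀ ℕ) := Finset.finsuppAntidiag Finset.univ e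
  have hS (b : Fin r →₀ ℕ) : b ∈ S ↔ b.degree = e := by
    simp [S, Finset.mem_finsuppAntidiag, Finsupp.degree_eq_sum]
  let G : MvPolynomial (Fin r) k :=
    ∑ b ∈ S, monomial b ((w.weight k b b)⁻¹ * l (monomial b 1))
  have hG (b) (hb : b.degree = e) : coeff b G = (w.weight k b b)⁻¹ * l (monomial b 1) := by
    rw [coeff_sum, Finset.sum_eq_single b]
    · rw [coeff_monomial, if_pos rfl]
    · intro c _ hc
      rw [coeff_monomial, if_neg hc]
    · exact fun h => absurd ((hS b).2 hb) h
  refine ⟨G, IsHomogeneous.sum _ _ _ fun b hb => isHomogeneous_monomial _ ((hS b).1 hb),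
    fun φ hφ => ?_⟩
  rw [coeff_act]
  conv_rhs => rw [φ.as_sum]
  rw [map_sum]
  refine Finset.sum_congr rfl fun a ha => ?_
  have had : a.degree = e := by
    by_contra h1
    exact mem_support_iff.1 ha (hφ.coeff_eq_zero h1)
  have hm : monomial a (coeff a φ) = coeff a φ • monomial a (1 : k) := by
    rw [smul_monomial, smul_eq_mul, mul_one]
  rw [zero_add, hG a had, mul_inv_cancel_left₀ (hw.weight_ne_zero le_rfl had.le), hm, map_smul,
    smul_eq_mul]

end Action

/-! ### Macaulay duality for level ideals -/

section Level

attribute [local instance] MvPolynomial.gradedAlgebra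

open Module

variable {k : Type*} [Field k] {r e t : ℕ} {w : ActionKind}

instance finite_homogeneousSubmodule (u : ℕ) :
    Module.Finite k (homogeneousSubmodule (Fin r) k u) :=
  Module.Finite.iff_fg.2 (homogeneousSubmodule_fg (Fin r) k u)

instance finite_gradedPiece (I : Ideal (MvPolynomial (Fin r) k)) (u : ℕ) :
    Module.Finite k (gradedPiece I u) := by
  unfold gradedPiece
  infer_instance

theorem mk_mem_socle {I : Ideal (MvPolynomial (Fin r) k)} {φ : MvPolynomial (Fin r) k} :
    Ideal.Quotient.mk I φ ∈ socle I ↔ ∀ j, X j * φ ∈ I := by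
  constructor
  · intro h j
    rw [← Ideal.Quotient.eq_zero_iff_mem, mul_comm, map_mul]
    exact h _ (Ideal.subset_span ⟨j, rfl⟩)
  · intro h m hm
    induction hm using Submodule.span_induction with
    | mem x hx =>
      obtain ⟨j, rfl⟩ := hx
      rw [← map_mul, mul_comm, Ideal.Quotient.eq_zero_iff_mem]
      exact h j
    | zero => rw [mul_zero]
    | add x y _ _ hx hy => rw [mul_add, hx, hy, add_zero]
    | smul c x _ hx => rw [smul_eq_mul, mul_left_comm, hx, mul_zero]

theorem hVector_add_finrank (I : Ideal (MvPolynomial (Fin r) k)) (u : ℕ) :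
    hVector I u + finrank k (homogeneousSubmodule (Fin r) k u ⊓ I.restrictScalars k :
      Submodule k (MvPolynomial (Fin r) k)) = finrank k (homogeneousSubmodule (Fin r) k u) := by
  have h : LinearMap.ker (Ideal.Quotient.mkₐ k I).toLinearMap = I.restrictScalars k :=
    Submodule.ext fun φ => Ideal.Quotient.eq_zero_iff_mem
  rw [← h]
  exact finrank_map_add_finrank_inf_ker (Ideal.Quotient.mkₐ k I).toLinearMap _

/-- Macaulay duality in the top degree. -/
theorem mem_of_forall_act_eq_zero_top (hw : w.Admissible k e)
    {I : Ideal (MvPolynomial (Fin r) k)} (hI : I.IsHomogeneous (homogeneousSubmodule (Fin r) k))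
    {φ : MvPolynomial (Fin r) k} (hφ : φ.IsHomogeneous e)
    (h : ∀ G ∈ inverseSystemPart w I e, act w φ G = 0) : φ ∈ I := by
  by_contra hφI
  have hφI' : φ ∉ (homogeneousSubmodule (Fin r) k e ⊓ I.restrictScalars k) := fun h => hφI h.2
  -- A functional vanishing on `I_e` but not at `φ` is pairing with a form `G`. It remains to see
  -- that all of `I`, not only `I_e`, kills `G`: a component `ψ_i` of `ψ ∈ I` is multiplied up into
  -- `I_e`, and nondegeneracy gives `ψ_i ∘ G = 0`.
  obtain ⟨l, hl, hlI⟩ := Submodule.exists_le_ker_of_notMem hφI'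
  obtain ⟨G, hG, hGl⟩ := exists_coeff_zero_act_eq (r := r) hw l
  refine hl ?_
  rw [← hGl φ hφ, h G ⟨fun ψ hψ => ?_, hG⟩, coeff_zero]
  rw [← sum_homogeneousComponent ψ, map_sum, LinearMap.sum_apply]
  refine Finset.sum_eq_zero fun i _ => ?_
  have hψi := homogeneousComponent_isHomogeneous i ψ
  rcases lt_or_ge e i with hi | hi
  · exact act_eq_zero_of_lt w hψi hG hi
  · refine eq_zero_of_coeff_zero_act hw (isHomogeneous_act w hψi hG) (Nat.sub_le e i)
      fun χ hχ => ?_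
    have hχψ : (χ * homogeneousComponent i ψ).IsHomogeneous e := by
      have := hχ.mul hψi
      rwa [Nat.sub_add_cancel hi] at this
    rw [← act_mul, hGl _ hχψ]
    exact hlI ⟨hχψ, I.mul_mem_left _ (homogeneousComponent_mem_of_mem hI hψ i)⟩

/-- A level ideal is cut out, in degrees at most `e`, by the top part of its inverse system. -/
theorem IsLevel.mem_of_forall_act_eq_zero (hw : w.Admissible k e)
    {I : Ideal (MvPolynomial (Fin r) k)} (hI : IsLevel I e t) {u : ℕ} (hu : u ≤ e)
    {φ : MvPolynomial (Fin r) k} (hφ : φ.IsHomogeneous u)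
    (h : ∀ G ∈ inverseSystemPart w I e, act w φ G = 0) : φ ∈ I := by
  induction hu using Nat.decreasingInduction generalizing φ with
  | self => exact mem_of_forall_act_eq_zero_top hw hI.homogeneous hφ h
  | of_succ u hu ih =>
    -- By the descending induction the class of `φ` is in the socle, which is zero in degree `u <
    -- e`.
    have hX (j : Fin r) : X j * φ ∈ I := by
      refine ih ?_ fun G hG => by rw [act_mul, h G hG, map_zero]
      rw [add_comm]
      exact (isHomogeneous_X k j).mul hφ
    have hs := hI.socleVector_eq u
    rw [if_neg hu.ne, socleVector, Submodule.finrank_eq_zero] at hs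
    rw [← Ideal.Quotient.eq_zero_iff_mem, ← Submodule.mem_bot k, ← hs]
    exact ⟨mk_mem_socle.2 hX, φ, hφ, rfl⟩

end Level
end LevelAlgebra

namespace LevelAlgebra

/-! ### Algebras defined by a single form -/

section Gorenstein

attribute [local instance] MvPolynomial.gradedAlgebra

open Module

variable {k : Type*} [Field k] {r e t : ℕ} {w : ActionKind}

/-- The map `φ ↦ φ ∘ G` on `R_u` has kernel `Ann(G)_u`; this turns h-vectors into ranks. -/
theorem hVector_ann (w : ActionKind) (G : MvPolynomial (Fin r) k) (u : ℕ) :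
    hVector (ann w G) u =
      finrank k ((homogeneousSubmodule (Fin r) k u).map ((act w).flip G)) := by
  have h : LinearMap.ker ((act w).flip G) = (ann w G).restrictScalars k := rfl
  have h1 := hVector_add_finrank (ann w G) u
  have h2 := finrank_map_add_finrank_inf_ker ((act w).flip G) (homogeneousSubmodule (Fin r) k u)
  rw [h] at h2
  omega

theorem hVector_ann_eq_zero {G : MvPolynomial (Fin r) k} (hG : G.IsHomogeneous e) {u : ℕ}
    (hu : e < u) : hVector (ann w G) u = 0 := by
  rw [hVector_ann]
  have : (homogeneousSubmodule (Fin r) k u).map ((act w).flip G) = ⊥ := by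
    rw [eq_bot_iff]
    rintro _ ⟨φ, hφ, rfl⟩
    rw [Submodule.mem_bot, LinearMap.flip_apply]
    exact act_eq_zero_of_lt w ((mem_homogeneousSubmodule u φ).1 hφ) hG hu
  rw [this, finrank_bot]

theorem hVector_ann_self (hw : w.Admissible k e) {G : MvPolynomial (Fin r) k}
    (hG : G.IsHomogeneous e) (hG0 : G ≠ 0) : hVector (ann w G) e = 1 := by
  rw [hVector_ann]
  have hle : (homogeneousSubmodule (Fin r) k e).map ((act w).flip G) ≤ k ∙ 1 := by
    rintro _ ⟨φ, hφ, rfl⟩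
    have h := isHomogeneous_act w hφ hG
    rw [Nat.sub_self, ← totalDegree_zero_iff_isHomogeneous, totalDegree_eq_zero_iff_eq_C] at h
    refine Submodule.mem_span_singleton.2 ⟨coeff 0 (act w φ G), ?_⟩
    rw [LinearMap.flip_apply, smul_eq_C_mul, mul_one, ← h]
  have hne : (homogeneousSubmodule (Fin r) k e).map ((act w).flip G) ≠ ⊥ := by
    intro h
    refine hG0 (eq_zero_of_coeff_zero_act hw hG le_rfl fun φ hφ => ?_)
    have h1 : act w φ G = 0 := (Submodule.eq_bot_iff _).1 h _ ⟨φ, hφ, rfl⟩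
    rw [h1, coeff_zero]
  have h1 := Submodule.finrank_mono hle
  rw [finrank_span_singleton one_ne_zero] at h1
  have h2 : finrank k ((homogeneousSubmodule (Fin r) k e).map ((act w).flip G)) ≠ 0 :=
    fun h => hne (Submodule.finrank_eq_zero.1 h)
  omega

theorem isHomogeneous_ann {G : MvPolynomial (Fin r) k} (hG : G.IsHomogeneous e) :
    (ann w G).IsHomogeneous (homogeneousSubmodule (Fin r) k) := by
  intro i φ hφ
  have h : homogeneousComponent i φ ∈ ann w G := by
    change act w (homogeneousComponent i φ) G = 0
    rcases lt_or_ge e i with hi | hi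
    · exact act_eq_zero_of_lt w (homogeneousComponent_isHomogeneous i φ) hG hi
    · have hφ' : act w φ G = 0 := hφ
      rw [← homogeneousComponent_act w φ hG hi, hφ', map_zero]
  rwa [← decomposition.decompose'_apply] at h

theorem finite_quotient_ann {G : MvPolynomial (Fin r) k} (hG : G.IsHomogeneous e) :
    Module.Finite k (MvPolynomial (Fin r) k ⧸ ann w G) := by
  refine Module.Finite.of_surjective
    ((Ideal.Quotient.mkₐ k (ann w G)).toLinearMap.domRestrict (restrictTotalDegree (Fin r) k e))
    (LinearMap.range_eq_top.1 ?_)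
  rw [LinearMap.range_domRestrict, eq_top_iff]
  rintro x -
  obtain ⟨φ, rfl⟩ := Ideal.Quotient.mk_surjective x
  induction φ using MvPolynomial.induction_on' with
  | add p q hp hq => rw [map_add]; exact Submodule.add_mem _ hp hq
  | monomial a c =>
  have ha := isHomogeneous_monomial (R := k) c (rfl : a.degree = a.degree)
  rcases lt_or_ge e a.degree with h | h
  · rw [Ideal.Quotient.eq_zero_iff_mem.2 (show monomial a c ∈ ann w G from
      act_eq_zero_of_lt w ha hG h)]
    exact Submodule.zero_mem _
  · exact ⟨_, (mem_restrictTotalDegree _ _ _).2 (ha.totalDegree_le.trans h), rfl⟩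

/-- Macaulay's theorem: a nonzero form of degree `e` defines a Gorenstein algebra of socle
degree `e`. -/
theorem isGorenstein_ann (hw : w.Admissible k e) {G : MvPolynomial (Fin r) k}
    (hG : G.IsHomogeneous e) (hG0 : G ≠ 0) : IsGorenstein (ann w G) e where
  homogeneous := isHomogeneous_ann hG
  artinian := by
    have := finite_quotient_ann (w := w) hG
    exact IsArtinianRing.of_finite k _
  hVector_pos := by rw [hVector_ann_self hw hG hG0]; exact one_pos
  hVector_eq_zero i hi := hVector_ann_eq_zero hG hi
  socleVector_eq i := by
    split_ifs with hi
    · subst hi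
      have h : gradedPiece (ann w G) i ≤ socle (ann w G) := by
        rintro _ ⟨φ, hφ, rfl⟩
        refine mk_mem_socle.2 fun j => ?_
        exact act_eq_zero_of_lt w ((isHomogeneous_X k j).mul hφ) hG (by omega)
      rw [socleVector, inf_eq_right.2 h]
      exact hVector_ann_self hw hG hG0
    · rw [socleVector, Submodule.finrank_eq_zero, eq_bot_iff]
      rintro _ ⟨hs, φ, hφ, rfl⟩
      have hX := mk_mem_socle.1 hs
      have hφ' : φ ∈ ann w G := by
        rcases lt_or_ge e i with h | h
        · exact act_eq_zero_of_lt w hφ hG h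
        -- Here `i < e`, so `φ ∘ G` has positive degree `e - i` and vanishes once all variables kill
        -- it.
        · refine eq_zero_of_act_X hw (isHomogeneous_act w hφ hG) (Nat.sub_le e i) (by omega)
            fun j => ?_
          rw [← act_mul]
          exact hX j
      exact Ideal.Quotient.eq_zero_iff_mem.2 hφ'

/-- The dimension of `A_v` is at most that of `∑ j, R_u ∘ F j`, when `u + v = e`. -/
theorem hVector_le_finrank_iSup (hw : w.Admissible k e) {I : Ideal (MvPolynomial (Fin r) k)}
    {ι : Type*} [Finite ι] {F : ι → MvPolynomial (Fin r) k} (hF : ∀ j, (F j).IsHomogeneous e)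
    {u v : ℕ} (huv : u + v = e)
    (hIF : ∀ φ : MvPolynomial (Fin r) k, φ.IsHomogeneous v → (∀ j, act w φ (F j) = 0) → φ ∈ I) :
    hVector I v ≤ finrank k
      (⨆ j, (homogeneousSubmodule (Fin r) k u).map ((act w).flip (F j)) :
        Submodule k (MvPolynomial (Fin r) k)) := by
  set Y := (⨆ j, (homogeneousSubmodule (Fin r) k u).map ((act w).flip (F j)) :
        Submodule k (MvPolynomial (Fin r) k)) with hY
  -- The pairing takes the constant term of `ψ ∘ y`. An element `ψ` of its kernel pairs to zero with
  -- every `φ ∘ F j`, so each `ψ ∘ F j` is zero by nondegeneracy and `ψ ∈ I`.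
  let T : homogeneousSubmodule (Fin r) k v →ₗ[k] Dual k Y :=
    ((act w).compr₂ (lcoeff k 0)).domRestrict₁₂ (homogeneousSubmodule (Fin r) k v) Y
  have hT : (LinearMap.ker T).map (homogeneousSubmodule (Fin r) k v).subtype ≤
      homogeneousSubmodule (Fin r) k v ⊓ I.restrictScalars k := by
    rintro _ ⟨ψ, hψ, rfl⟩
    refine ⟨ψ.2, hIF _ ψ.2 fun j => ?_⟩
    refine eq_zero_of_coeff_zero_act hw (d := u) ?_ (by omega) fun φ hφ => ?_
    · have := isHomogeneous_act w ψ.2 (hF j)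
      rwa [show e - v = u by omega] at this
    · rw [act_comm]
      have hmem : act w φ (F j) ∈ Y := Submodule.mem_iSup_of_mem j ⟨φ, hφ, rfl⟩
      exact LinearMap.congr_fun (LinearMap.mem_ker.1 hψ) ⟨_, hmem⟩
  have h1 := Submodule.finrank_mono hT
  rw [Submodule.finrank_map_subtype_eq] at h1
  have h2 := LinearMap.finrank_range_add_finrank_ker T
  have h3 := hVector_add_finrank I v
  have h4 := Submodule.finrank_le (LinearMap.range T)
  rw [Subspace.dual_finrank_eq] at h4
  omega

end Gorenstein

/-! ### Zariski open sets and generic ranks -/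

section Generic

open Module

variable {k : Type*} [Field k]

theorem eval_smul_of_isHomogeneous {ι : Type*} [Fintype ι] {g : MvPolynomial ι k} {d : ℕ}
    (hg : g.IsHomogeneous d) (c : k) (v : ι → k) : eval (c • v) g = c ^ d * eval v g := by
  rw [eval_eq', eval_eq', Finset.mul_sum]
  refine Finset.sum_congr rfl fun a ha => ?_
  have hd : ∑ i, a i = d := by
    rw [← Finsupp.degree_eq_sum]
    by_contra h
    exact mem_support_iff.1 ha (hg.coeff_eq_zero h)
  simp only [Pi.smul_apply, smul_eq_mul, mul_pow, Finset.prod_mul_distrib, Finset.prod_pow_eq_pow_sum,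
    hd]
  ring

theorem exists_projectivization_eval_ne_zero [Infinite k] {t : ℕ} {i : Fin t}
    {D : MvPolynomial (Fin t) k} (hD : D ≠ 0) :
    ∃ p : Projectivization k (Fin t → k), ∃ c : k, c ≠ 0 ∧ eval (c • p.rep) D ≠ 0 := by
  -- The factor `X i` keeps `v` away from the origin; the scalar `c` is needed because `rep` only
  -- recovers `v` up to a unit and `D` need not be homogeneous.
  obtain ⟨v, hv⟩ := exists_eval_ne_zero (mul_ne_zero hD (X_ne_zero (R := k) i))
  rw [map_mul, eval_X, mul_ne_zero_iff] at hv
  have hv0 : v ≠ 0 := by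
    rintro rfl
    exact hv.2 rfl
  obtain ⟨a, ha⟩ := Projectivization.exists_smul_eq_mk_rep k v hv0
  refine ⟨Projectivization.mk k v hv0, ((a⁻¹ : kˣ) : k), (a⁻¹).ne_zero, ?_⟩
  rw [← ha, ← Units.smul_def, inv_smul_smul]
  exact hv.1

/-- Nonempty Zariski open subsets of projective space over an infinite field intersect. -/
theorem IsZariskiOpen.inter_nonempty [Infinite k] {t : ℕ}
    {U U' : Set (Projectivization k (Fin t → k))} (hU : IsZariskiOpen U) (hU' : IsZariskiOpen U')
    (hne : U.Nonempty) (hne' : U'.Nonempty) : (U ∩ U').Nonempty := by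
  obtain ⟨T, hT, rfl⟩ := hU
  obtain ⟨T', hT', rfl⟩ := hU'
  obtain ⟨p, g, hg, hp⟩ := hne
  obtain ⟨p', g', hg', hp'⟩ := hne'
  obtain ⟨i, -⟩ := Function.ne_iff.1 p.rep_nonzero
  have h0 : g ≠ 0 := by
    rintro rfl
    exact hp (map_zero _)
  have h0' : g' ≠ 0 := by
    rintro rfl
    exact hp' (map_zero _)
  obtain ⟨q, c, hc, hq⟩ := exists_projectivization_eval_ne_zero (i := i) (mul_ne_zero h0 h0')
  obtain ⟨d, hd⟩ := hT g hg
  obtain ⟨d', hd'⟩ := hT' g' hg'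
  rw [map_mul, eval_smul_of_isHomogeneous hd, eval_smul_of_isHomogeneous hd'] at hq
  simp only [mul_ne_zero_iff] at hq
  exact ⟨q, ⟨g, hg, hq.1.2⟩, ⟨g', hg', hq.2.2⟩⟩

theorem IsGenericGorensteinHVector.unique [Infinite k] {r e t : ℕ} {w : ActionKind}
    {I : Ideal (MvPolynomial (Fin r) k)} {F : Fin t → MvPolynomial (Fin r) k} {H H' : ℕ → ℕ}
    (h : IsGenericGorensteinHVector w I e F H) (h' : IsGenericGorensteinHVector w I e F H') :
    H = H' := by
  obtain ⟨U, hU, hne, hH⟩ := h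
  obtain ⟨U', hU', hne', hH'⟩ := h'
  obtain ⟨p, hp, hp'⟩ := hU.inter_nonempty hU' hne hne'
  funext u
  rw [← (hH p hp).2.2 u, (hH' p hp').2.2 u]

/-- The ranks in finitely many linear systems of maps are maximal simultaneously, off the zero
locus of a nonzero homogeneous polynomial. -/
theorem exists_isHomogeneous_forall_finrank_range_le [Infinite k] {ι : Type*} [Fintype ι]
    {V : ℕ → Type*} [∀ u, AddCommGroup (V u)] [∀ u, Module k (V u)]
    [∀ u, FiniteDimensional k (V u)] {W : Type*} [AddCommGroup W] [Module k W]
    (f : ∀ u, ι → V u →ₗ[k] W) (s : Finset ℕ) :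
    ∃ (D : MvPolynomial ι k) (d : ℕ), D ≠ 0 ∧ D.IsHomogeneous d ∧ ∀ p, eval p D ≠ 0 →
      ∀ u ∈ s, ∀ q : ι → k, finrank k (LinearMap.range (∑ j, q j • f u j)) ≤
        finrank k (LinearMap.range (∑ j, p j • f u j)) := by
  have key (u : ℕ) : ∃ (D : MvPolynomial ι k) (d : ℕ), D ≠ 0 ∧ D.IsHomogeneous d ∧ ∀ p,
      eval p D ≠ 0 → ∀ q : ι → k, finrank k (LinearMap.range (∑ j, q j • f u j)) ≤
        finrank k (LinearMap.range (∑ j, p j • f u j)) := by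
    have hbdd : BddAbove (Set.range fun q : ι → k =>
        finrank k (LinearMap.range (∑ j, q j • f u j))) := by
      refine ⟨finrank k (V u), ?_⟩
      rintro _ ⟨q, rfl⟩
      exact LinearMap.finrank_range_le _
    -- The ranks are bounded, so the maximum is attained at some `p₀`, and semicontinuity spreads it
    -- to an open set.
    obtain ⟨p₀, hp₀⟩ := Nat.sSup_mem (Set.range_nonempty _) hbdd
    obtain ⟨D, d, hD, h0, h⟩ := exists_isHomogeneous_finrank_range_le (f u) p₀
    refine ⟨D, d, ?_, hD, fun p hp q => ?_⟩
    · rintro rfl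
      exact h0 (map_zero _)
    · exact (le_csSup hbdd ⟨q, rfl⟩).trans (hp₀.symm.le.trans (h p hp))
  choose D d h0 hD h using key
  refine ⟨∏ u ∈ s, D u, ∑ u ∈ s, d u, Finset.prod_ne_zero_iff.2 fun u _ => h0 u,
    IsHomogeneous.prod _ _ _ fun u _ => hD u, fun p hp u hu => h u p ?_⟩
  rw [map_prod] at hp
  exact Finset.prod_ne_zero_iff.1 hp u hu

/-- The linear system of maps `φ ↦ φ ∘ F j` on the forms of degree `u`. -/
noncomputable def catalecticant {r : ℕ} {ι : Type*} (w : ActionKind)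
    (F : ι → MvPolynomial (Fin r) k) (u : ℕ) (j : ι) :
    homogeneousSubmodule (Fin r) k u →ₗ[k] MvPolynomial (Fin r) k :=
  ((act w).flip (F j)).domRestrict (homogeneousSubmodule (Fin r) k u)

theorem sum_smul_catalecticant {r : ℕ} {ι : Type*} [Fintype ι] (w : ActionKind)
    (F : ι → MvPolynomial (Fin r) k) (u : ℕ) (p : ι → k) :
    ∑ j, p j • catalecticant w F u j =
      ((act w).flip (∑ j, p j • F j)).domRestrict (homogeneousSubmodule (Fin r) k u) := by
  ext1 φ
  simp [catalecticant]

theorem finrank_range_catalecticant {r : ℕ} {ι : Type*} [Fintype ι] (w : ActionKind)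
    (F : ι → MvPolynomial (Fin r) k) (u : ℕ) (p : ι → k) :
    finrank k (LinearMap.range (∑ j, p j • catalecticant w F u j)) =
      hVector (ann w (∑ j, p j • F j)) u := by
  rw [sum_smul_catalecticant, LinearMap.range_domRestrict, hVector_ann]

end Generic

/-! ### Generic Gorenstein quotients of a level algebra -/

section Main

open Module

variable {k : Type*} [Field k] {r e t : ℕ} {w : ActionKind}
  {I : Ideal (MvPolynomial (Fin r) k)}

theorem forall_act_basis_eq_zero_iff (F : Basis (Fin t) k (inverseSystemPart w I e))
    {φ : MvPolynomial (Fin r) k} :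
    (∀ j, act w φ (F j).1 = 0) ↔ ∀ G ∈ inverseSystemPart w I e, act w φ G = 0 := by
  refine ⟨fun h G hG => ?_, fun h j => h _ (F j).2⟩
  have := congrArg Subtype.val (F.sum_repr ⟨G, hG⟩)
  rw [Submodule.coe_sum] at this
  rw [← show _ = G from this, map_sum]
  refine Finset.sum_eq_zero fun j _ => ?_
  rw [Submodule.coe_smul, map_smul, h j, smul_zero]

theorem IsLevel.mem_iff_forall_act_basis (hw : w.Admissible k e) (hI : IsLevel I e t)
    (F : Basis (Fin t) k (inverseSystemPart w I e)) {u : ℕ} (hu : u ≤ e)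
    {φ : MvPolynomial (Fin r) k} (hφ : φ.IsHomogeneous u) :
    φ ∈ I ↔ ∀ j, act w φ (F j).1 = 0 :=
  ⟨fun h j => (F j).2.1 φ h, fun h =>
    hI.mem_of_forall_act_eq_zero hw hu hφ ((forall_act_basis_eq_zero_iff F).1 h)⟩

/-- With no forms `F j`, duality would put all of `R_e` in `I`. Positivity of `t` supplies a
coordinate, hence a point of the projective space. -/
theorem IsLevel.type_pos (hw : w.Admissible k e) (hI : IsLevel I e t)
    (F : Basis (Fin t) k (inverseSystemPart w I e)) : 0 < t := by
  by_contra ht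
  obtain rfl : t = 0 := by omega
  refine hI.hVector_pos.ne' ?_
  rw [hVector, Submodule.finrank_eq_zero, eq_bot_iff]
  rintro _ ⟨φ, hφ, rfl⟩
  exact Ideal.Quotient.eq_zero_iff_mem.2
    ((hI.mem_iff_forall_act_basis hw F le_rfl hφ).2 fun j => j.elim0)

theorem isHomogeneous_formAt (F : Basis (Fin t) k (inverseSystemPart w I e))
    (p : Projectivization k (Fin t → k)) :
    (formAt (fun j => (F j).1) p).IsHomogeneous e :=
  IsHomogeneous.sum _ _ _ fun j _ =>
    (homogeneousSubmodule (Fin r) k e).smul_mem _ (F j).2.2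

theorem formAt_ne_zero (F : Basis (Fin t) k (inverseSystemPart w I e))
    (p : Projectivization k (Fin t → k)) : formAt (fun j => (F j).1) p ≠ 0 := by
  intro h
  have h1 : ∑ j, p.rep j • F j = 0 := Subtype.ext (by simpa [formAt] using h)
  exact p.rep_nonzero (funext (Fintype.linearIndependent_iff.1 F.linearIndependent _ h1))

theorem le_ann_formAt (F : Basis (Fin t) k (inverseSystemPart w I e))
    (p : Projectivization k (Fin t → k)) : I ≤ ann w (formAt (fun j => (F j).1) p) := by
  intro φ hφ
  exact (Submodule.sum_mem _ fun j _ => Submodule.smul_mem _ _ (F j).2.1 :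
    formAt (fun j => (F j).1) p ∈ inverseSystem w I) φ hφ

/-- The rank bound for the catalecticants: their common kernel is `I_u`, so `dim R_u` minus it is
`h_u`, and the sum of their ranges accounts for `h_{e-u}`. -/
theorem IsLevel.hVector_add_hVector_le [Infinite k] (hw : w.Admissible k e) (hI : IsLevel I e t)
    (F : Basis (Fin t) k (inverseSystemPart w I e)) {u : ℕ} (hu : u ≤ e) {p : Fin t → k}
    (hp : p ≠ 0)
    (hmax : ∀ q : Fin t → k,
      finrank k (LinearMap.range (∑ j, q j • catalecticant w (fun j => (F j).1) u j)) ≤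
        finrank k (LinearMap.range (∑ j, p j • catalecticant w (fun j => (F j).1) u j))) :
    hVector I (e - u) + hVector I u ≤ (t + 1) * hVector (ann w (∑ j, p j • (F j).1)) u := by
  have h1 := finrank_add_finrank_iSup_range_le _ hp hmax
  rw [finrank_range_catalecticant, Fintype.card_fin] at h1
  have h2 := hVector_add_finrank I u
  have h3 : (⨅ j, LinearMap.ker (catalecticant w (fun j => (F j).1) u j)).map
      (homogeneousSubmodule (Fin r) k u).subtype =
        homogeneousSubmodule (Fin r) k u ⊓ I.restrictScalars k := by
    ext φ
    constructor
    · rintro ⟨ψ, hψ, rfl⟩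
      exact ⟨ψ.2, (hI.mem_iff_forall_act_basis hw F hu ψ.2).2 ((Submodule.mem_iInf _).1 hψ)⟩
    · rintro ⟨hφ, hφI⟩
      exact ⟨⟨φ, hφ⟩, (Submodule.mem_iInf _).2
        ((hI.mem_iff_forall_act_basis hw F hu hφ).1 hφI), rfl⟩
  rw [← h3, Submodule.finrank_map_subtype_eq] at h2
  have h4 := hVector_le_finrank_iSup hw (I := I) (fun j => (F j).2.2) (Nat.add_sub_of_le hu)
    fun φ hφ h => (hI.mem_iff_forall_act_basis hw F (Nat.sub_le e u) hφ).2 h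
  have h5 (j) : LinearMap.range (catalecticant w (fun j => (F j).1) u j) =
      (homogeneousSubmodule (Fin r) k u).map ((act w).flip (F j).1) :=
    LinearMap.range_domRestrict _ _
  rw [iSup_congr h5] at h1
  omega

theorem IsLevel.exists_isGenericGorensteinHVector [Infinite k] (hw : w.Admissible k e) (hI : IsLevel I e t)
    (F : Basis (Fin t) k (inverseSystemPart w I e)) :
    ∃ H : ℕ → ℕ, IsGenericGorensteinHVector w I e (fun j => (F j).1) H ∧
      ∀ u ≤ e, hVector I (e - u) + hVector I u ≤ (t + 1) * H u := by
  obtain ⟨D, d, hD0, hD, hmax⟩ := exists_isHomogeneous_forall_finrank_range_le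
    (catalecticant w fun j => (F j).1) (Finset.range (e + 1))
  obtain ⟨p, c, -, hp⟩ := exists_projectivization_eval_ne_zero (i := ⟨0, hI.type_pos hw F⟩) hD0
  rw [eval_smul_of_isHomogeneous hD, mul_ne_zero_iff] at hp
  -- The sequence is read off at one good point `p`. At any other point of the open set each of the
  -- two ranks is maximal, so they agree; above degree `e` both are zero.
  refine ⟨hVector (ann w (formAt (fun j => (F j).1) p)), ⟨{q | eval q.rep D ≠ 0}, ⟨{D}, ?_, ?_⟩,
    ⟨p, hp.2⟩, fun q hq => ⟨le_ann_formAt F q,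
      isGorenstein_ann hw (isHomogeneous_formAt F q) (formAt_ne_zero F q), fun u => ?_⟩⟩,
    fun u hu => hI.hVector_add_hVector_le hw F hu p.rep_nonzero
      (hmax _ hp.2 u (Finset.mem_range.2 (by omega)))⟩
  · rintro _ rfl
    exact ⟨d, hD⟩
  · simp
  · rcases lt_or_ge e u with hu | hu
    · rw [hVector_ann_eq_zero (isHomogeneous_formAt F q) hu,
        hVector_ann_eq_zero (isHomogeneous_formAt F p) hu]
    · have hu' : u ∈ Finset.range (e + 1) := Finset.mem_range.2 (by omega)
      have h1 := hmax _ hp.2 u hu' q.rep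
      have h2 := hmax _ hq u hu' p.rep
      rw [finrank_range_catalecticant, finrank_range_catalecticant] at h1 h2
      exact le_antisymm h1 h2

end Main

end LevelAlgebra

theorem corollary2p5 {k : Type*} [Field k] [Infinite k] {r e t : ℕ}
    (w : LevelAlgebra.ActionKind)
    (hw : w = LevelAlgebra.ActionKind.differentiation → ringChar k = 0 ∨ e < ringChar k)
    (I : Ideal (MvPolynomial (Fin r) k)) (hI : LevelAlgebra.IsLevel I e t)
    (F : Module.Basis (Fin t) k (LevelAlgebra.inverseSystemPart w I e)) :
    (∃! H : ℕ → ℕ, LevelAlgebra.IsGenericGorensteinHVector w I e (fun j => (F j).1) H) ∧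
    ∀ H : ℕ → ℕ, LevelAlgebra.IsGenericGorensteinHVector w I e (fun j => (F j).1) H →
      ∀ u : ℕ, 1 ≤ u → u ≤ e →
        ((LevelAlgebra.hVector I (e - u) : ℚ) + LevelAlgebra.hVector I u) / (t + 1) ≤ H u := by
  obtain ⟨H₀, hH₀, hle⟩ := hI.exists_isGenericGorensteinHVector hw F
  refine ⟨⟨H₀, hH₀, fun H hH => hH.unique hH₀⟩, fun H hH u _ hu => ?_⟩
  rw [hH.unique hH₀, div_le_iff₀ (by positivity), mul_comm]
  exact_mod_cast hle u hu
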